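/- Let $d\in\{2,3\}$ and let $\mathcal G=(\mathcal V,\mathcal E)$ be a simple undirected graph on $\mathcal V=\{1,\dots,n\}$ and $\mathcal A\subseteq\mathcal V^3$ a set of triples. For $p=(p_1,\dots,p_n)\in\mathbb R^{dn}$, $p_i\in\mathbb R^d$, and $(k,i,j)\in\mathcal A$ let $\theta^k_{ij}(p)\in[0,\pi]$ be the angle between $p_i-p_k$ and $p_j-p_k$. Let $\chi\subseteq\mathbb R^{dn}$ be the set of all $p$ with $p_k\ne p_i$ and $p_k\neq p_j$ for every $(k,i,j)\in\mathcal A$, and let $$F_W:\chi\to\mathbb R^{|\mathcal E|+|\mathcal A|},\qquad F_W(p)=\big((\|p_i-p_j\|^2)_{(i,j)\in\mathcal E},\ (\cos\theta^k_{ij}(p))_{(k,i,j)\in\mathcal A}\big),$$ with Jacobian $R_W(p)=\partial F_W/\partial p$. A point $p\in\chi$ is a *regular point* of $F_W$ if $\operatorname{rank}R_W(p)=\max_{q\in\chi}\operatorname{rank}R_W(q)$. For $p\in\chi$, the framework $(\mathcal G,\mathcal A,p)$ is *GWR* (generalized weakly rigid) if there is a neighbourhood $B$ of $p$ such that every $q\in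 B\cap\chi$ with $F_W(q)=F_W(p)$ satisfies $\|q_i-q_j\|=\|p_i-p_j\|$ for all $i,j\in\mathcal V$; when $\mathcal E=\emptyset$, it is also called GWR if there is a neighbourhood $B$ of $p$ such that for every $q\in B\cap\chi$ with $F_W(q)=F_W(p)$ there is a constant $C>0$ with $\|q_i-q_j\|=C\|p_i-p_j\|$ for all $i,j\in\mathcal V$. It is *GIWR* (generalized infinitesimally weakly rigid) if every $v\in\mathbb R^{dn}$ with $R_W(p)v=0$ has the form $v_i=t+Jp_i+cp_i$ ($i\in\mathcal V$) with $t\in\mathbb R^d$, $J$ a skew-symmetric $d\times d$ matrix and $c\in\mathbb R$, where $c=0$ if $\mathcal E\neq\emptyset$. If $n=2$, assume that $\mathcal E$ and $\mathcal A$ are not both empty. If $(\mathcal G,\mathcal A,p)$ is GWR (respectively GIWR) for some regular point $p$ of $F_W$, then $(\mathcal G,\mathcal A,q)$ is GWR (respectively GIWR) for every regular point $q$ of $F_W$. Hence both properties are generic: for given $(\mathcal G,\mathcal A)$ and $d$, each of them holds at all regular points of $F_W$ or at none of them. -/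

import Mathlib

open Topology

namespace WeakRigidity

/-- Configurations `p = (p₁, …, pₙ)` of `n` points of Euclidean `d`-space. -/
abbrev Config (d n : ℕ) : Type := Fin n → EuclideanSpace ℝ (Fin d)

variable {d n : ℕ}

/-- The cosine of the angle at the vertex `k` between `i` and `j`, for a triple `a = (k, i, j)`. -/
noncomputable def cosAngle (a : Fin n × Fin n × Fin n) (p : Config d n) : ℝ :=
  Real.cos (EuclideanGeometry.angle (p a.2.1) (p a.1) (p a.2.2))

/-- The domain `χ`: for every `(k, i, j)` in the angle set the denominator
`‖p k - p i‖ * ‖p k - p j‖` of the cosine is nonzero. -/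
def domain (A : Finset (Fin n × Fin n × Fin n)) : Set (Config d n) :=
  {p | ∀ a ∈ A, p a.1 ≠ p a.2.1 ∧ p a.1 ≠ p a.2.2}

/-- The edges of `G`, each listed once, as the pair of its endpoints in increasing order. -/
abbrev Edge (G : SimpleGraph (Fin n)) : Type :=
  {e : Fin n × Fin n // e.1 < e.2 ∧ G.Adj e.1 e.2}

/-- The weak rigidity function `F_W`: squared lengths of the edges and cosines of the angles.
It is meaningful on `domain A`. -/
noncomputable def weakRigidityFun (G : SimpleGraph (Fin n)) (A : Finset (Fin n × Fin n × Fin n))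
    (p : Config d n) : Edge G ⊕ A → ℝ :=
  Sum.elim (fun e => ‖p e.1.1 - p e.1.2‖ ^ 2) (fun a => cosAngle a.1 p)

/-- The weak rigidity matrix `R_W(p)`, the Jacobian of `F_W` at `p`, as a linear map. -/
noncomputable def weakRigidityMatrix (G : SimpleGraph (Fin n))
    (A : Finset (Fin n × Fin n × Fin n)) (p : Config d n) :
    Config d n →ₗ[ℝ] (Edge G ⊕ A → ℝ) :=
  (fderiv ℝ (weakRigidityFun G A) p : Config d n →ₗ[ℝ] (Edge G ⊕ A → ℝ))

/-- The rank of the weak rigidity matrix. -/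
noncomputable def weakRigidityRank (G : SimpleGraph (Fin n))
    (A : Finset (Fin n × Fin n × Fin n)) (p : Config d n) : ℕ :=
  Module.finrank ℝ (LinearMap.range (weakRigidityMatrix G A p))

/-- `p` is a regular point of `F_W`: it lies in the domain, and the rank of the Jacobian at `p` is
the maximum of the ranks over the domain. -/
def IsRegularPoint (G : SimpleGraph (Fin n)) (A : Finset (Fin n × Fin n × Fin n))
    (p : Config d n) : Prop :=
  p ∈ domain A ∧
    IsGreatest {r : ℕ | ∃ q : Config d n, q ∈ domain A ∧ weakRigidityRank G A q = r}
      (weakRigidityRank G A p)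

/-- Congruent configurations. -/
def Congruent (p q : Config d n) : Prop :=
  ∀ i j, ‖p i - p j‖ = ‖q i - q j‖

/-- Proportionally congruent configurations. -/
def ProportionallyCongruent (p q : Config d n) : Prop :=
  ∃ C : ℝ, 0 < C ∧ ∀ i j, ‖p i - p j‖ = C * ‖q i - q j‖

/-- Angle equivalent configurations. -/
def AngleEquivalent (A : Finset (Fin n × Fin n × Fin n)) (p q : Config d n) : Prop :=
  ∀ a ∈ A, cosAngle a p = cosAngle a q

/-- Strongly equivalent configurations. -/
def StronglyEquivalent (G : SimpleGraph (Fin n)) (A : Finset (Fin n × Fin n × Fin n))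
    (p q : Config d n) : Prop :=
  (∀ i j, G.Adj i j → ‖p i - p j‖ = ‖q i - q j‖) ∧ ∀ a ∈ A, cosAngle a p = cosAngle a q

/-- Generalized weak rigidity (GWR) of the framework `(G, A, p)`. The second alternative is
available only for an empty edge set (`G = ⊥`). The frameworks `(G, A, q)` that are compared with
`(G, A, p)` are those whose angles are all defined. -/
def IsGWR (G : SimpleGraph (Fin n)) (A : Finset (Fin n × Fin n × Fin n))
    (p : Config d n) : Prop :=
  (∃ B ∈ 𝓝 p, ∀ q ∈ B, q ∈ domain A → StronglyEquivalent G A q p → Congruent q p) ∨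
  (G = ⊥ ∧
    ∃ B ∈ 𝓝 p, ∀ q ∈ B, q ∈ domain A → AngleEquivalent A q p → ProportionallyCongruent q p)

/-- `v` is an infinitesimal motion of `(G, A, p)`: `R_W(p) v = 0`. -/
def IsInfinitesimalMotion (G : SimpleGraph (Fin n)) (A : Finset (Fin n × Fin n × Fin n))
    (p v : Config d n) : Prop :=
  weakRigidityMatrix G A p v = 0

/-- `v` is trivial at `p`: the sum of an infinitesimal translation `t`, an infinitesimal rotation
`J` (a skew-symmetric matrix) and, only if there are no edges, a scaling `c`. -/
def IsTrivialMotion (G : SimpleGraph (Fin n)) (p v : Config d n) : Prop :=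
  ∃ (t : EuclideanSpace ℝ (Fin d)) (J : Matrix (Fin d) (Fin d) ℝ) (c : ℝ),
    J.transpose = -J ∧ (G ≠ ⊥ → c = 0) ∧
      ∀ i, v i = t + Matrix.toEuclideanLin J (p i) + c • p i

/-- Generalized infinitesimal weak rigidity (GIWR): all infinitesimal motions are trivial. -/
def IsGIWR (G : SimpleGraph (Fin n)) (A : Finset (Fin n × Fin n × Fin n))
    (p : Config d n) : Prop :=
  ∀ v : Config d n, IsInfinitesimalMotion G A p v → IsTrivialMotion G p v

/-- A property of configurations is generic for `(G, A)` if it holds at all regular points of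
`F_W` or at none of them. -/
def IsGenericProperty (G : SimpleGraph (Fin n)) (A : Finset (Fin n × Fin n × Fin n))
    (P : Config d n → Prop) : Prop :=
  (∀ p, IsRegularPoint G A p → P p) ∨ ∀ p, IsRegularPoint G A p → ¬ P p

end WeakRigidity

/-! The two properties coincide at regular points, so it is enough to transfer the infinitesimal
one.

GIWR implies GWR at every point of the domain (`IsGIWR.isGWR`). The similarities close to the
identity, parametrized by exponentials, move `p` inside its fibre of `F_W`, and the tangent space of
this orbit is the space of trivial motions. If that space is the whole kernel of `R_W(p)`, the orbit
fills the fibre near `p` (`eventually_fibre_subset_range`).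

Conversely, the rank is locally maximal at a regular point, so every kernel vector is the velocity
of a curve in the fibre (`exists_curve_in_fibre`). Under GWR the curve consists of congruent or
similar configurations, and differentiating its Gram matrix shows that its velocity is trivial
(`IsGWR.isGIWR`).

GIWR passes from one regular point to another by counting dimensions. All regular points have the
same nullity, and GIWR at `p` bounds it by the dimension of the Lie algebra of similarities (of
isometries, if there are edges). If that algebra acts injectively on `q`, the trivial motions at `q`
already have this dimension, hence exhaust the kernel. Otherwise `q` is collinear because `d ≤ 3`.
Every cosine is critical at a collinear configuration, so the nullity at `q` is too large when `n ≥
3`. The case `n ≤ 1` is trivial. For `n = 2` any two distinct points are GIWR, and the assumption on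
the edges and angles prevents the points of a regular configuration from coinciding. -/

namespace WeakRigidity

open scoped InnerProductSpace

/-! ### Generalized inverses of linear maps -/

section GeneralizedInverse

variable {K V W : Type*} [Field K] [AddCommGroup V] [Module K V] [AddCommGroup W] [Module K W]

/-- Every linear map of vector spaces has a generalized inverse. -/
theorem exists_generalizedInverse (f : V →ₗ[K] W) :
    ∃ s : W →ₗ[K] V, ∀ x, f (s (f x)) = f x := by
  obtain ⟨g, hg⟩ := f.rangeRestrict.exists_rightInverse_of_surjective f.range_rangeRestrict
  obtain ⟨s, hs⟩ := g.exists_extend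
  refine ⟨s, fun x => ?_⟩
  have h1 : s (f x) = g ⟨f x, x, rfl⟩ := by rw [← hs]; rfl
  have h2 := congrArg Subtype.val (LinearMap.congr_fun hg ⟨f x, x, rfl⟩)
  rw [h1]
  exact h2

/-- A linear map which vanishes on the kernel of `f` factors through `f`. -/
theorem exists_comp_eq_of_ker_le {U : Type*} [AddCommGroup U] [Module K U]
    (f : V →ₗ[K] W) (g : V →ₗ[K] U) (h : ∀ x, f x = 0 → g x = 0) :
    ∃ a : W →ₗ[K] U, ∀ x, a (f x) = g x := by
  obtain ⟨s, hs⟩ := exists_generalizedInverse f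
  refine ⟨g ∘ₗ s, fun x => ?_⟩
  have := h (s (f x) - x) (by rw [map_sub, hs, sub_self])
  rwa [map_sub, sub_eq_zero] at this

end GeneralizedInverse

/-! ### Fibres of a differentiable map: covering them, and curves inside them -/

section Fibres

variable {E H : Type*} [NormedAddCommGroup E] [NormedSpace ℝ E]
  [NormedAddCommGroup H] [NormedSpace ℝ H]

theorem exists_continuous_generalizedInverse [FiniteDimensional ℝ H] (f : E →L[ℝ] H) :
    ∃ s : H →L[ℝ] E, ∀ x, f (s (f x)) = f x := by
  obtain ⟨s, hs⟩ := exists_generalizedInverse (f : E →ₗ[ℝ] H)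
  exact ⟨LinearMap.toContinuousLinearMap s, hs⟩

/-- The change of coordinates which straightens `F` up to first order at a point where `F` has
derivative `f`. -/
def straighten (F : E → H) (f : E →L[ℝ] H) (s : H →L[ℝ] E) (x : E) : E :=
  x + s (F x - f x)

theorem hasStrictFDerivAt_straighten {F : E → H} {f g : E →L[ℝ] H} (s : H →L[ℝ] E) {x : E}
    (hF : HasStrictFDerivAt F g x) :
    HasStrictFDerivAt (straighten F f s) (ContinuousLinearMap.id ℝ E + s.comp (g - f)) x :=
  (hasStrictFDerivAt_id x).add (s.hasStrictFDerivAt.comp x (hF.sub f.hasStrictFDerivAt))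

theorem hasStrictFDerivAt_straighten_self {F : E → H} {f : E →L[ℝ] H} (s : H →L[ℝ] E) {x : E}
    (hF : HasStrictFDerivAt F f x) :
    HasStrictFDerivAt (straighten F f s)
      ((ContinuousLinearEquiv.refl ℝ E : E ≃L[ℝ] E) : E →L[ℝ] E) x := by
  have h := hasStrictFDerivAt_straighten (f := f) s hF
  have e : ContinuousLinearMap.id ℝ E + s.comp (f - f)
      = ((ContinuousLinearEquiv.refl ℝ E : E ≃L[ℝ] E) : E →L[ℝ] E) := by
    ext y; simp
  rwa [e] at h

/-- If a map `ψ` into the fibre of `F` through `p = ψ a` has a derivative at `a` whose range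
contains the kernel of the derivative of `F` at `p`, then `ψ` covers the fibre near `p`. -/
theorem eventually_fibre_subset_range [FiniteDimensional ℝ E] {P : Type*} [NormedAddCommGroup P] [NormedSpace ℝ P]
    [FiniteDimensional ℝ P] [FiniteDimensional ℝ H] {F : E → H} {f : E →L[ℝ] H} {ψ : P → E} {l : P →L[ℝ] E} {a : P}
    (hψ : HasStrictFDerivAt ψ l a) (hF : HasStrictFDerivAt F f (ψ a))
    (hconst : ∀ y, F (ψ y) = F (ψ a)) (hker : ∀ v, f v = 0 → ∃ y, l y = v) :
    ∀ᶠ q in 𝓝 (ψ a), F q = F (ψ a) → ∃ y, ψ y = q := by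
  obtain ⟨s, hs⟩ := exists_continuous_generalizedInverse f
  have hΦ := hasStrictFDerivAt_straighten_self s hF
  let K : Submodule ℝ E := LinearMap.ker (f : E →ₗ[ℝ] H)
  let π : E →L[ℝ] K := (ContinuousLinearMap.id ℝ E - s.comp f).codRestrict K (fun x => by
    change f (x - s (f x)) = 0
    rw [map_sub, hs, sub_self])
  have hπ : ∀ v ∈ K, (π v : E) = v := by
    intro v hv
    have hv' : f v = 0 := hv
    change v - s (f v) = v
    rw [hv', map_zero, sub_zero]
  -- `π` fixes the kernel of `f` and the range of `l` contains it, so `π ∘ ψ` is a submersion at `a`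
  -- and its image is a neighbourhood of `π (ψ a)`.
  have hsurj : (π.comp l).range = ⊤ := by
    rw [LinearMap.range_eq_top]
    rintro ⟨v, hv⟩
    obtain ⟨y, hy⟩ := hker v hv
    refine ⟨y, Subtype.ext ?_⟩
    change (π (l y) : E) = v
    rw [hy, hπ v hv]
  have hmap := (π.hasStrictFDerivAt.comp a hψ).map_nhds_eq_of_surj hsurj
  let Φ := hΦ.toOpenPartialHomeomorph (straighten F f s)
  have hsrc : Φ.source ∈ 𝓝 (ψ a) :=
    Φ.open_source.mem_nhds hΦ.mem_toOpenPartialHomeomorph_source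
  have himg : (fun y => π (ψ y)) '' (ψ ⁻¹' Φ.source) ∈ 𝓝 (π (ψ a)) := by
    replace hmap : Filter.map (fun y => π (ψ y)) (𝓝 a) = 𝓝 (π (ψ a)) := hmap
    rw [← hmap]
    exact Filter.image_mem_map (hψ.continuousAt hsrc)
  filter_upwards [hsrc, π.continuous.continuousAt himg] with q hq ⟨y, hy, hyq⟩ hFq
  -- On the fibre, the straightened map differs from `π` only by the constant `s (F (ψ a))`. Points
  -- of the fibre with the same `π` therefore have the same image under the locally injective `Φ`.
  refine ⟨y, Φ.injOn hy hq ?_⟩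
  change ψ y + s (F (ψ y) - f (ψ y)) = q + s (F q - f q)
  have h1 : ψ y - s (f (ψ y)) = q - s (f q) := congrArg Subtype.val hyq
  rw [hconst, hFq, map_sub, map_sub, add_sub_left_comm, h1, add_sub_left_comm]

/-- A form of the constant rank theorem: where the rank of the derivative of `F` is locally
maximal, every vector in the kernel of the derivative is tangent to a curve in the fibre. -/
theorem exists_curve_in_fibre [FiniteDimensional ℝ E] [FiniteDimensional ℝ H] {F : E → H} {p v : E} (hF : ContDiffAt ℝ 1 F p)
    (hrank : ∀ᶠ x in 𝓝 p, Module.finrank ℝ (LinearMap.range (fderiv ℝ F x : E →ₗ[ℝ] H)) ≤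
      Module.finrank ℝ (LinearMap.range (fderiv ℝ F p : E →ₗ[ℝ] H)))
    (hv : fderiv ℝ F p v = 0) :
    ∃ γ : ℝ → E, γ 0 = p ∧ HasDerivAt γ v 0 ∧ ∀ᶠ t in 𝓝 (0 : ℝ), F (γ t) = F p := by
  set f := fderiv ℝ F p with hf
  obtain ⟨s, hs⟩ := exists_continuous_generalizedInverse f
  have hFp : HasStrictFDerivAt F f p := hF.hasStrictFDerivAt one_ne_zero
  have hΦ := hasStrictFDerivAt_straighten_self s hFp
  have hΦC : ContDiffAt ℝ 1 (straighten F f s) p :=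
    contDiffAt_id.add (s.contDiff.contDiffAt.comp p (hF.sub f.contDiff.contDiffAt))
  let g := hΦ.localInverse (straighten F f s) _ p
  have hgC : ContDiffAt ℝ 1 g (straighten F f s p) :=
    hΦC.to_localInverse hΦ.hasFDerivAt one_ne_zero
  have hgp : g (straighten F f s p) = p := hΦ.localInverse_apply_image
  -- The required curve is the preimage of this line under the straightening, whose derivative at
  -- `p` is the identity.
  let line : ℝ → E := fun t => straighten F f s p + t • v
  have hline : ∀ t, HasDerivAt line v t := fun t => by
    have h := ((hasDerivAt_id t).smul_const v).const_add (straighten F f s p)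
    rwa [one_smul] at h
  have hline0 : line 0 = straighten F f s p := by simp [line]
  have hlinec : ContinuousAt line 0 := (hline 0).continuousAt
  have hγ0 : g (line 0) = p := by rw [hline0, hgp]
  have hγd : HasDerivAt (fun t => g (line t)) v 0 := by
    have h := hΦ.to_localInverse.hasFDerivAt
    rw [← hline0] at h
    exact h.comp_hasDerivAt 0 (hline 0)
  have hγdiff : ∀ᶠ t in 𝓝 (0 : ℝ), DifferentiableAt ℝ (fun t => g (line t)) t := by
    have h1 : ∀ᶠ y in 𝓝 (line 0), ContDiffAt ℝ 1 g y := by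
      rw [hline0]; exact hgC.eventually (by simp)
    filter_upwards [hlinec.eventually h1] with t ht
    exact (ht.differentiableAt one_ne_zero).comp t (hline t).differentiableAt
  have hγc : Filter.Tendsto (fun t => g (line t)) (𝓝 0) (𝓝 p) := by
    have := hγd.continuousAt
    rwa [ContinuousAt, hγ0] at this
  have hright : ∀ᶠ t in 𝓝 (0 : ℝ), straighten F f s (g (line t)) = line t := by
    have := hΦ.eventually_right_inverse
    rw [← hline0] at this
    exact hlinec.eventually this
  -- This operator is the derivative of the straightening at `x`; it is the identity at `p`, and
  -- invertibility is an open condition.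
  have hunit : ∀ᶠ x in 𝓝 p, IsUnit (ContinuousLinearMap.id ℝ E + s.comp (fderiv ℝ F x - f)) := by
    have hc : ContinuousAt
        (fun x => ContinuousLinearMap.id ℝ E + s.comp (fderiv ℝ F x - f)) p := by
      have h1 : ContinuousAt (fderiv ℝ F) p :=
        (hF.fderiv_right (m := 0) (by simp)).continuousAt
      have h2 : Continuous (fun u : E →L[ℝ] H => ContinuousLinearMap.id ℝ E + s.comp (u - f)) := by
        fun_prop
      exact h2.continuousAt.comp h1
    refine hc.eventually (Units.isOpen.mem_nhds ?_)
    change IsUnit (ContinuousLinearMap.id ℝ E + s.comp (f - f))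
    rw [sub_self, ContinuousLinearMap.comp_zero, add_zero]
    exact isUnit_one
  -- Invertibility makes `f ∘ s` map the range of the derivative at `x` onto a space containing the
  -- range of `f`. Since the rank at `x` is at most the rank at `p`, no dimension can be lost, so `f
  -- ∘ s` is injective on that range.
  have hinj : ∀ᶠ x in 𝓝 p, ∀ u, f (s (fderiv ℝ F x u)) = 0 → fderiv ℝ F x u = 0 := by
    filter_upwards [hunit, hrank] with x hx hr u hu
    let D : E →ₗ[ℝ] H := (fderiv ℝ F x : E →ₗ[ℝ] H)
    let Q : H →ₗ[ℝ] H := (f : E →ₗ[ℝ] H) ∘ₗ (s : H →ₗ[ℝ] E)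
    have hQ : LinearMap.range (f : E →ₗ[ℝ] H) ≤ (LinearMap.range D).map Q := by
      rintro _ ⟨w, rfl⟩
      obtain ⟨e, he⟩ := hx
      have h1 : (e : E →L[ℝ] E) ((↑e⁻¹ : E →L[ℝ] E) w) = w := by
        rw [← mul_apply_eq_comp, e.mul_inv]; rfl
      refine ⟨D ((↑e⁻¹ : E →L[ℝ] E) w), ⟨_, rfl⟩, ?_⟩
      set z := (↑e⁻¹ : E →L[ℝ] E) w
      rw [he] at h1
      have h2 : z + s (fderiv ℝ F x z - f z) = w := h1
      change f (s (fderiv ℝ F x z)) = f w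
      rw [← h2, map_add, map_sub, map_sub, hs]
      abel
    have h3 := Submodule.finrank_mono hQ
    have h4 : Module.finrank ℝ ((LinearMap.range D).map Q) =
        Module.finrank ℝ (LinearMap.range (Q.domRestrict (LinearMap.range D))) := by
      rw [LinearMap.range_domRestrict]
    have h5 := (Q.domRestrict (LinearMap.range D)).finrank_range_add_finrank_ker
    have h6 : Module.finrank ℝ (LinearMap.ker (Q.domRestrict (LinearMap.range D))) = 0 := by
      have : Module.finrank ℝ (LinearMap.range D) ≤
        Module.finrank ℝ (LinearMap.range (f : E →ₗ[ℝ] H)) := hr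
      omega
    rw [Submodule.finrank_eq_zero, LinearMap.ker_eq_bot'] at h6
    exact congrArg Subtype.val (h6 ⟨D u, u, rfl⟩ hu)
  have hFdiff : ∀ᶠ x in 𝓝 p, DifferentiableAt ℝ F x :=
    (hF.eventually (by simp)).mono fun x hx => hx.differentiableAt one_ne_zero
  have hall := (((hγdiff.and hright).and (hγc.eventually hinj)).and (hγc.eventually hFdiff))
  obtain ⟨ε, hε, hball⟩ := Metric.eventually_nhds_iff_ball.1 hall
  -- Apply `f` to the equation of the line: `f ∘ s ∘ f = f` cancels the linear terms, and `f v = 0`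
  -- removes the dependence on `t`.
  have hQconst : ∀ t ∈ Metric.ball (0 : ℝ) ε, f (s (F (g (line t)))) = f (s (F p)) := by
    intro t ht
    have h1 : g (line t) + s (F (g (line t)) - f (g (line t))) =
      (p + s (F p - f p)) + t • v := (hball t ht).1.1.2
    have h2 := congrArg f h1
    simp only [map_add, map_sub, map_smul, hs, hv, smul_zero, add_zero] at h2
    simpa using h2
  refine ⟨fun t => g (line t), hγ0, hγd, ?_⟩
  -- The derivative of `F` along the curve lies in the range of the derivative of `F` and is killed
  -- by `f ∘ s`, so it vanishes by `hinj`.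
  have hconst : ∀ t ∈ Metric.ball (0 : ℝ) ε, HasDerivAt (fun t => F (g (line t))) 0 t := by
    intro t ht
    obtain ⟨⟨⟨h1, -⟩, h2⟩, h3⟩ := hball t ht
    have h4 := h3.hasFDerivAt.comp_hasDerivAt t h1.hasDerivAt
    have h5 : HasDerivAt (fun t => f (s (F (g (line t)))))
        (f (s (fderiv ℝ F (g (line t)) (deriv (fun t => g (line t)) t)))) t :=
      (f.comp s).hasFDerivAt.comp_hasDerivAt t h4
    have h6 : HasDerivAt (fun t => f (s (F (g (line t))))) 0 t :=
      (hasDerivAt_const t (f (s (F p)))).congr_of_eventuallyEq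
        (Filter.eventually_of_mem (Metric.isOpen_ball.mem_nhds ht) hQconst)
    rw [h2 _ (h5.unique h6)] at h4
    exact h4
  filter_upwards [Metric.ball_mem_nhds (0 : ℝ) hε] with t ht
  have h := Metric.isOpen_ball.is_const_of_deriv_eq_zero
    (convex_ball (0 : ℝ) ε).isPreconnected
    (fun t ht => (hconst t ht).differentiableAt.differentiableWithinAt)
    (fun t ht => (hconst t ht).deriv) ht (Metric.mem_ball_self hε)
  simpa [hγ0] using h

end Fibres

/-! ### Extending an infinitesimal isometry of a finite set of vectors -/

section Skew

variable {E ι : Type*} [NormedAddCommGroup E] [InnerProductSpace ℝ E] [FiniteDimensional ℝ E]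
  [Fintype ι]

/-- Vectors `y i` which satisfy the linear relations and the infinitesimal isometry relations of
the vectors `x i` are the images of the `x i` under a skew-adjoint map. -/
theorem exists_skewAdjoint_apply_eq (x y : ι → E)
    (hrel : ∀ c : ι → ℝ, ∑ i, c i • x i = 0 → ∑ i, c i • y i = 0)
    (hinner : ∀ i j, ⟪x i, y j⟫_ℝ + ⟪y i, x j⟫_ℝ = 0) :
    ∃ J : E →L[ℝ] E, star J = -J ∧ ∀ i, J (x i) = y i := by
  classical
  let X : (ι → ℝ) →ₗ[ℝ] E := Fintype.linearCombination ℝ x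
  let Y : (ι → ℝ) →ₗ[ℝ] E := Fintype.linearCombination ℝ y
  have hX : ∀ c, X c = ∑ i, c i • x i := fun c => Fintype.linearCombination_apply ℝ x c
  have hY : ∀ c, Y c = ∑ i, c i • y i := fun c => Fintype.linearCombination_apply ℝ y c
  obtain ⟨a, ha⟩ := exists_comp_eq_of_ker_le X Y (fun c hc => by
    rw [hY]; exact hrel c (by rw [← hX]; exact hc))
  let A : E →L[ℝ] E := LinearMap.toContinuousLinearMap a
  have hA : ∀ i, A (x i) = y i := fun i => by
    have h := ha (Pi.single i 1)
    simp only [X, Y, Fintype.linearCombination_apply_single, one_smul] at h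
    exact h
  have hskew : ∀ w ∈ LinearMap.range X, ⟪A w, w⟫_ℝ = 0 := by
    rintro _ ⟨c, rfl⟩
    have h1 : A (X c) = Y c := ha c
    have h2 : ⟪Y c, X c⟫_ℝ = ∑ i, ∑ j, c i * c j * ⟪y i, x j⟫_ℝ := by
      simp only [hX, hY, sum_inner, inner_sum, real_inner_smul_left, real_inner_smul_right,
        mul_assoc]
      refine Finset.sum_comm.trans (Finset.sum_congr rfl fun i _ => Finset.sum_congr rfl fun j _ => ?_)
      ring
    have h3 : ∑ i, ∑ j, c i * c j * ⟪y i, x j⟫_ℝ = -∑ i, ∑ j, c i * c j * ⟪y i, x j⟫_ℝ := by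
      conv_lhs => rw [Finset.sum_comm]
      rw [← Finset.sum_neg_distrib]
      refine Finset.sum_congr rfl fun i _ => ?_
      rw [← Finset.sum_neg_distrib]
      refine Finset.sum_congr rfl fun j _ => ?_
      have := hinner i j
      rw [real_inner_comm] at this
      linear_combination c i * c j * this
    rw [h1, h2]
    linarith
  -- `A` is controlled only on the span of the `x i`, and may map it outside itself. Subtracting the
  -- adjoint of `A ∘ P` on the orthogonal complement cancels the mixed term of the quadratic form of
  -- `A ∘ P`, leaving `⟪A (P w), P w⟫ = 0`; polarization then gives skew-adjointness.
  let P : E →L[ℝ] E := (LinearMap.range X).starProjection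
  let B : E →L[ℝ] E := A.comp P
  let J : E →L[ℝ] E := B - (ContinuousLinearMap.adjoint B).comp (ContinuousLinearMap.id ℝ E - P)
  have hP : ∀ w, ⟪A (P w), w - P w⟫_ℝ = ⟪w - P w, A (P w)⟫_ℝ := fun w => real_inner_comm _ _
  have hJ : ∀ w, ⟪J w, w⟫_ℝ = 0 := by
    intro w
    have h1 : ⟪J w, w⟫_ℝ = ⟪A (P w), w⟫_ℝ - ⟪w - P w, A (P w)⟫_ℝ := by
      change ⟪B w - ContinuousLinearMap.adjoint B (w - P w), w⟫_ℝ = _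
      rw [inner_sub_left, ContinuousLinearMap.adjoint_inner_left]
      rfl
    have h2 := hskew (P w) (Submodule.starProjection_apply_mem _ w)
    rw [h1, ← hP, inner_sub_right, h2]
    ring
  refine ⟨J, ?_, fun i => ?_⟩
  · rw [ContinuousLinearMap.star_eq_adjoint, eq_comm, ContinuousLinearMap.eq_adjoint_iff]
    intro u w
    have h1 := hJ (u + w)
    simp only [map_add, inner_add_left, inner_add_right, hJ] at h1
    rw [neg_apply, inner_neg_left, real_inner_comm (J w) u]
    linarith
  · have h1 : P (x i) = x i := by
      refine Submodule.starProjection_eq_self_iff.2 ⟨Pi.single i 1, ?_⟩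
      simp [X, Fintype.linearCombination_apply_single]
    change A (P (x i)) - ContinuousLinearMap.adjoint B (x i - P (x i)) = y i
    rw [h1, sub_self, map_zero, sub_zero, hA]

end Skew

/-! ### Smoothness of `F_W` and the entries of its Jacobian -/

section Derivatives

variable {d n : ℕ}

theorem cosAngle_eq_div (a : Fin n × Fin n × Fin n) (p : Config d n) :
    cosAngle a p = ⟪p a.2.1 - p a.1, p a.2.2 - p a.1⟫_ℝ /
      (‖p a.2.1 - p a.1‖ * ‖p a.2.2 - p a.1‖) :=
  InnerProductGeometry.cos_angle _ _

theorem isOpen_domain (A : Finset (Fin n × Fin n × Fin n)) :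
    IsOpen (domain A : Set (Config d n)) := by
  have : (domain A : Set (Config d n)) =
      ⋂ a ∈ A, {p | p a.1 ≠ p a.2.1} ∩ {p | p a.1 ≠ p a.2.2} := by
    ext p; simp [domain]
  rw [this]
  exact isOpen_biInter_finset fun a _ =>
    (isOpen_ne_fun (by fun_prop) (by fun_prop)).inter (isOpen_ne_fun (by fun_prop) (by fun_prop))

theorem contDiffAt_cosAngle {a : Fin n × Fin n × Fin n} {p : Config d n}
    (h1 : p a.1 ≠ p a.2.1) (h2 : p a.1 ≠ p a.2.2) : ContDiffAt ℝ 1 (cosAngle a) p := by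
  have e : (cosAngle a : Config d n → ℝ) = fun p => ⟪p a.2.1 - p a.1, p a.2.2 - p a.1⟫_ℝ /
      (‖p a.2.1 - p a.1‖ * ‖p a.2.2 - p a.1‖) := funext (cosAngle_eq_div a)
  have hsub : ∀ i j : Fin n, ContDiffAt ℝ 1 (fun p : Config d n => p i - p j) p := fun i j =>
    (contDiff_apply ℝ _ i).contDiffAt.sub (contDiff_apply ℝ _ j).contDiffAt
  have h1' : p a.2.1 - p a.1 ≠ 0 := sub_ne_zero.2 h1.symm
  have h2' : p a.2.2 - p a.1 ≠ 0 := sub_ne_zero.2 h2.symm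
  rw [e]
  exact ((hsub _ _).inner ℝ (hsub _ _)).div
    (((hsub _ _).norm ℝ h1').mul ((hsub _ _).norm ℝ h2'))
    (mul_ne_zero (norm_ne_zero_iff.2 h1') (norm_ne_zero_iff.2 h2'))

noncomputable instance fintypeEdge (G : SimpleGraph (Fin n)) : Fintype (Edge G) :=
  Fintype.ofFinite _

theorem contDiffAt_weakRigidityFun (G : SimpleGraph (Fin n)) {A : Finset (Fin n × Fin n × Fin n)}
    {p : Config d n} (hp : p ∈ domain A) : ContDiffAt ℝ 1 (weakRigidityFun G A) p := by
  rw [contDiffAt_pi]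
  rintro (e | a)
  · exact ((contDiff_apply ℝ _ e.1.1).contDiffAt.sub
      (contDiff_apply ℝ _ e.1.2).contDiffAt).norm_sq ℝ
  · exact contDiffAt_cosAngle (hp a.1 a.2).1 (hp a.1 a.2).2

theorem differentiableAt_weakRigidityFun (G : SimpleGraph (Fin n))
    {A : Finset (Fin n × Fin n × Fin n)} {p : Config d n} (hp : p ∈ domain A) :
    DifferentiableAt ℝ (weakRigidityFun G A) p :=
  (contDiffAt_weakRigidityFun G hp).differentiableAt one_ne_zero

theorem weakRigidityMatrix_apply_edge {G : SimpleGraph (Fin n)}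
    {A : Finset (Fin n × Fin n × Fin n)} {p : Config d n} (hp : p ∈ domain A) (v : Config d n)
    (e : Edge G) : weakRigidityMatrix G A p v (Sum.inl e) =
      2 * ⟪p e.1.1 - p e.1.2, v e.1.1 - v e.1.2⟫_ℝ := by
  have h1 := hasFDerivAt_pi'.1 (differentiableAt_weakRigidityFun G hp).hasFDerivAt (Sum.inl e)
  have h2 : HasFDerivAt (fun p : Config d n => p e.1.1 - p e.1.2)
      (ContinuousLinearMap.proj (R := ℝ) (φ := fun _ : Fin n => EuclideanSpace ℝ (Fin d)) e.1.1 -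
        ContinuousLinearMap.proj (R := ℝ) (φ := fun _ : Fin n => EuclideanSpace ℝ (Fin d)) e.1.2)
      p := (hasFDerivAt_apply e.1.1 p).sub (hasFDerivAt_apply e.1.2 p)
  refine (DFunLike.congr_fun (h1.unique h2.norm_sq) v).trans ?_
  simp [inner_sub_left, inner_sub_right]

theorem weakRigidityMatrix_apply_angle {G : SimpleGraph (Fin n)}
    {A : Finset (Fin n × Fin n × Fin n)} {p : Config d n} (hp : p ∈ domain A) (v : Config d n)
    (a : A) : weakRigidityMatrix G A p v (Sum.inr a) = fderiv ℝ (cosAngle a.1) p v := by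
  have h1 := hasFDerivAt_pi'.1 (differentiableAt_weakRigidityFun G hp).hasFDerivAt (Sum.inr a)
  exact (DFunLike.congr_fun h1.fderiv v).symm

end Derivatives

/-! ### Similarities, their Lie algebra and the trivial motions -/

section Similarities

variable {d n : ℕ}

/-- The space of infinitesimal similarities of `ℝ^d`, without dilations if `G` has an edge. -/
noncomputable def infSimilarities (d : ℕ) (G : SimpleGraph (Fin n)) :
    Submodule ℝ (EuclideanSpace ℝ (Fin d) ×
      (EuclideanSpace ℝ (Fin d) →L[ℝ] EuclideanSpace ℝ (Fin d)) × ℝ) where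
  carrier := {x | star x.2.1 = -x.2.1 ∧ (G ≠ ⊥ → x.2.2 = 0)}
  add_mem' := by
    rintro x y ⟨h1, h2⟩ ⟨h3, h4⟩
    refine ⟨?_, fun h => ?_⟩
    · change star (x.2.1 + y.2.1) = -(x.2.1 + y.2.1)
      exact (star_add x.2.1 y.2.1).trans (by rw [h1, h3, neg_add])
    · change x.2.2 + y.2.2 = 0
      rw [h2 h, h4 h, add_zero]
  zero_mem' := ⟨(star_zero (EuclideanSpace ℝ (Fin d) →L[ℝ] EuclideanSpace ℝ (Fin d))).trans
    neg_zero.symm, fun _ => rfl⟩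
  smul_mem' := by
    rintro c x ⟨h1, h2⟩
    refine ⟨?_, fun h => ?_⟩
    · change star (c • x.2.1) = -(c • x.2.1)
      exact (star_smul c x.2.1).trans (by rw [h1, smul_neg, star_trivial])
    · change c • x.2.2 = 0
      rw [h2 h, smul_zero]

/-- The velocities at the points of `p` of an infinitesimal similarity. -/
noncomputable def velocity (p : Config d n) :
    (EuclideanSpace ℝ (Fin d) ×
      (EuclideanSpace ℝ (Fin d) →L[ℝ] EuclideanSpace ℝ (Fin d)) × ℝ) →L[ℝ] Config d n :=
  LinearMap.toContinuousLinearMap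
    { toFun := fun x i => x.1 + x.2.1 (p i) + x.2.2 • p i
      map_add' := fun x y => by
        funext i
        simp only [Prod.fst_add, Prod.snd_add, add_apply, add_smul, Pi.add_apply]
        abel
      map_smul' := fun c x => by
        funext i
        simp [smul_add, mul_smul] }

theorem velocity_apply (p : Config d n) (x : EuclideanSpace ℝ (Fin d) ×
      (EuclideanSpace ℝ (Fin d) →L[ℝ] EuclideanSpace ℝ (Fin d)) × ℝ) (i : Fin n) :
    velocity p x i = x.1 + x.2.1 (p i) + x.2.2 • p i := rfl

/-- The image of `p` under the similarity with logarithm `x`. -/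
noncomputable def moved (p : Config d n) (x : EuclideanSpace ℝ (Fin d) ×
      (EuclideanSpace ℝ (Fin d) →L[ℝ] EuclideanSpace ℝ (Fin d)) × ℝ) : Config d n :=
  fun i => x.1 + Real.exp x.2.2 • (NormedSpace.exp x.2.1) (p i)

theorem moved_zero (p : Config d n) : moved p 0 = p := by
  funext i
  simp [moved, NormedSpace.exp_zero]

theorem hasStrictFDerivAt_moved (p : Config d n) :
    HasStrictFDerivAt (moved p) (velocity p) 0 := by
  rw [hasStrictFDerivAt_pi']
  intro i
  let E := EuclideanSpace ℝ (Fin d)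
  let π₁ : E × (E →L[ℝ] E) × ℝ →L[ℝ] E := ContinuousLinearMap.fst ℝ _ _
  let π₂ : E × (E →L[ℝ] E) × ℝ →L[ℝ] (E →L[ℝ] E) :=
    (ContinuousLinearMap.fst ℝ _ _).comp (ContinuousLinearMap.snd ℝ _ _)
  let π₃ : E × (E →L[ℝ] E) × ℝ →L[ℝ] ℝ :=
    (ContinuousLinearMap.snd ℝ _ _).comp (ContinuousLinearMap.snd ℝ _ _)
  have h1 : HasStrictFDerivAt (fun x => NormedSpace.exp (π₂ x))
      ((1 : (E →L[ℝ] E) →L[ℝ] (E →L[ℝ] E)).comp π₂) 0 := by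
    refine HasStrictFDerivAt.comp (0 : E × (E →L[ℝ] E) × ℝ) ?_ π₂.hasStrictFDerivAt
    rw [map_zero]
    exact hasStrictFDerivAt_exp_zero
  have h2 : HasStrictFDerivAt (fun x => NormedSpace.exp (π₂ x) (p i)) _ 0 :=
    (ContinuousLinearMap.apply ℝ E (p i)).hasStrictFDerivAt.comp 0 h1
  have h3 : HasStrictFDerivAt (fun x => Real.exp (π₃ x)) _ 0 := π₃.hasStrictFDerivAt.exp
  have h4 := π₁.hasStrictFDerivAt.add (h3.smul h2)
  refine h4.congr_fderiv ?_
  ext x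
  all_goals simp [π₁, π₂, π₃, velocity, NormedSpace.exp_zero]

theorem moved_sub (p : Config d n) (x : EuclideanSpace ℝ (Fin d) ×
      (EuclideanSpace ℝ (Fin d) →L[ℝ] EuclideanSpace ℝ (Fin d)) × ℝ) (i j : Fin n) :
    moved p x i - moved p x j = Real.exp x.2.2 • (NormedSpace.exp x.2.1) (p i - p j) := by
  simp [moved, smul_sub]

theorem exp_mem_unitary {J : EuclideanSpace ℝ (Fin d) →L[ℝ] EuclideanSpace ℝ (Fin d)}
    (hJ : star J = -J) : NormedSpace.exp J ∈
      unitary (EuclideanSpace ℝ (Fin d) →L[ℝ] EuclideanSpace ℝ (Fin d)) :=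
  letI : NormedAlgebra ℚ (EuclideanSpace ℝ (Fin d) →L[ℝ] EuclideanSpace ℝ (Fin d)) :=
    NormedAlgebra.restrictScalars ℚ ℝ _
  NormedSpace.exp_mem_unitary_of_mem_skewAdjoint (skewAdjoint.mem_iff.2 hJ)

theorem norm_moved_sub {G : SimpleGraph (Fin n)} (p : Config d n) (x : infSimilarities d G)
    (i j : Fin n) : ‖moved p x.1 i - moved p x.1 j‖ = Real.exp x.1.2.2 * ‖p i - p j‖ := by
  rw [moved_sub, norm_smul,
    ContinuousLinearMap.norm_map_of_mem_unitary (exp_mem_unitary x.2.1), Real.norm_eq_abs,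
    Real.abs_exp]

theorem cosAngle_moved {G : SimpleGraph (Fin n)} (p : Config d n) (x : infSimilarities d G)
    (a : Fin n × Fin n × Fin n) : cosAngle a (moved p x.1) = cosAngle a p := by
  have he : Real.exp x.1.2.2 ≠ 0 := (Real.exp_pos _).ne'
  rw [cosAngle_eq_div, cosAngle_eq_div, norm_moved_sub, norm_moved_sub, moved_sub, moved_sub,
    real_inner_smul_left, real_inner_smul_right,
    ContinuousLinearMap.inner_map_map_of_mem_unitary (exp_mem_unitary x.2.1)]
  field_simp

theorem weakRigidityFun_moved {G : SimpleGraph (Fin n)} (A : Finset (Fin n × Fin n × Fin n))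
    (p : Config d n) (x : infSimilarities d G) :
    weakRigidityFun G A (moved p x.1) = weakRigidityFun G A p := by
  funext r
  rcases r with e | a
  · have hG : G ≠ ⊥ := by
      rintro rfl
      exact e.2.2
    change ‖_‖ ^ 2 = ‖_‖ ^ 2
    rw [norm_moved_sub, x.2.2 hG, Real.exp_zero, one_mul]
  · exact cosAngle_moved p x a.1

theorem isTrivialMotion_iff {G : SimpleGraph (Fin n)} {p v : Config d n} :
    IsTrivialMotion G p v ↔ ∃ x ∈ infSimilarities d G, velocity p x = v := by
  constructor
  · rintro ⟨t, J, c, hJ, hc, hv⟩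
    refine ⟨(t, Matrix.toEuclideanCLM (𝕜 := ℝ) J, c), ⟨?_, hc⟩, ?_⟩
    · change star (Matrix.toEuclideanCLM (𝕜 := ℝ) J) = -Matrix.toEuclideanCLM (𝕜 := ℝ) J
      rw [← map_star, Matrix.star_eq_conjTranspose, Matrix.conjTranspose_eq_transpose_of_trivial,
        hJ, map_neg]
    · funext i
      exact (hv i).symm
  · rintro ⟨⟨t, J, c⟩, ⟨hJ, hc⟩, rfl⟩
    have hJ' : star J = -J := hJ
    obtain ⟨M, hM⟩ := (Matrix.toEuclideanCLM (𝕜 := ℝ) (n := Fin d)).surjective J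
    have hM' : Matrix.toEuclideanCLM (𝕜 := ℝ) M = J := hM
    subst hM'
    refine ⟨t, M, c, ?_, hc, fun i => rfl⟩
    rw [← map_star, ← map_neg] at hJ'
    have := (Matrix.toEuclideanCLM (𝕜 := ℝ) (n := Fin d)).injective hJ'
    rwa [Matrix.star_eq_conjTranspose, Matrix.conjTranspose_eq_transpose_of_trivial] at this

/-- The velocities of `p` under the infinitesimal similarities allowed by `G`. -/
noncomputable def motionMap (G : SimpleGraph (Fin n)) (p : Config d n) :
    infSimilarities d G →L[ℝ] Config d n :=
  (velocity p).comp (infSimilarities d G).subtypeL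

theorem isTrivialMotion_iff_mem_range {G : SimpleGraph (Fin n)} {p v : Config d n} :
    IsTrivialMotion G p v ↔ ∃ x, motionMap G p x = v := by
  rw [isTrivialMotion_iff]
  exact ⟨fun ⟨x, hx, h⟩ => ⟨⟨x, hx⟩, h⟩, fun ⟨x, h⟩ => ⟨x.1, x.2, h⟩⟩

theorem hasStrictFDerivAt_moved_subtype (G : SimpleGraph (Fin n)) (p : Config d n) :
    HasStrictFDerivAt (fun x : infSimilarities d G => moved p x.1) (motionMap G p) 0 :=
  HasStrictFDerivAt.comp (g := moved p) (g' := velocity p)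
    (f := (infSimilarities d G).subtypeL) (0 : infSimilarities d G) (hasStrictFDerivAt_moved p)
    (ContinuousLinearMap.hasStrictFDerivAt (x := (0 : infSimilarities d G))
      (infSimilarities d G).subtypeL)

/-- `F_W` is constant on the orbit of `p`; the chain rule at the identity turns this into the
vanishing of `R_W(p)` on the velocities. -/
theorem IsTrivialMotion.isInfinitesimalMotion {G : SimpleGraph (Fin n)}
    {A : Finset (Fin n × Fin n × Fin n)} {p v : Config d n} (hp : p ∈ domain A)
    (hv : IsTrivialMotion G p v) : IsInfinitesimalMotion G A p v := by
  obtain ⟨x, rfl⟩ := isTrivialMotion_iff_mem_range.1 hv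
  have h0 : moved p (0 : infSimilarities d G).1 = p := moved_zero p
  have h1 : HasFDerivAt (weakRigidityFun G A) (fderiv ℝ (weakRigidityFun G A) p)
      (moved p (0 : infSimilarities d G).1) := by
    rw [h0]; exact (differentiableAt_weakRigidityFun G hp).hasFDerivAt
  have h2 := HasFDerivAt.comp (f := fun x : infSimilarities d G => moved p x.1) (0 : infSimilarities d G) h1
    (hasStrictFDerivAt_moved_subtype G p).hasFDerivAt
  have h3 : HasFDerivAt (weakRigidityFun G A ∘ fun x : infSimilarities d G => moved p x.1)
      (0 : infSimilarities d G →L[ℝ] (Edge G ⊕ A → ℝ)) 0 :=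
    (hasFDerivAt_const (weakRigidityFun G A p) _).congr_of_eventuallyEq
      (Filter.Eventually.of_forall fun x => weakRigidityFun_moved A p x)
  exact DFunLike.congr_fun (h2.unique h3) x

end Similarities

/-! ### GWR and GIWR agree at regular points -/

section Equivalence

variable {d n : ℕ} {G : SimpleGraph (Fin n)} {A : Finset (Fin n × Fin n × Fin n)}

theorem weakRigidityFun_eq_iff {p q : Config d n} :
    weakRigidityFun G A q = weakRigidityFun G A p ↔ StronglyEquivalent G A q p := by
  constructor
  · intro h
    have hlt : ∀ i j, i < j → G.Adj i j → ‖q i - q j‖ = ‖p i - p j‖ := fun i j hij hG => by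
      have := congrFun h (Sum.inl ⟨(i, j), hij, hG⟩)
      exact (sq_eq_sq₀ (norm_nonneg _) (norm_nonneg _)).1 this
    refine ⟨fun i j hij => ?_, fun a ha => congrFun h (Sum.inr ⟨a, ha⟩)⟩
    rcases lt_or_gt_of_ne hij.ne with h1 | h1
    · exact hlt i j h1 hij
    · rw [norm_sub_rev, norm_sub_rev (p i)]
      exact hlt j i h1 hij.symm
  · rintro ⟨h1, h2⟩
    funext r
    rcases r with e | a
    · change ‖_‖ ^ 2 = ‖_‖ ^ 2
      rw [h1 _ _ e.2.2]
    · exact h2 a.1 a.2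

theorem stronglyEquivalent_bot_iff {p q : Config d n} :
    StronglyEquivalent ⊥ A q p ↔ AngleEquivalent A q p :=
  ⟨fun h => h.2, fun h => ⟨fun _ _ hij => hij.elim, h⟩⟩

/-- Infinitesimal weak rigidity implies weak rigidity. -/
theorem IsGIWR.isGWR {p : Config d n} (hp : p ∈ domain A) (h : IsGIWR G A p) :
    IsGWR G A p := by
  have h0 : moved p (0 : infSimilarities d G).1 = p := moved_zero p
  have hF : HasStrictFDerivAt (weakRigidityFun G A) (fderiv ℝ (weakRigidityFun G A) p)
      (moved p (0 : infSimilarities d G).1) := by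
    rw [h0]; exact (contDiffAt_weakRigidityFun G hp).hasStrictFDerivAt one_ne_zero
  have hconst : ∀ x : infSimilarities d G, weakRigidityFun G A (moved p x.1) =
      weakRigidityFun G A (moved p (0 : infSimilarities d G).1) := fun x => by
    rw [weakRigidityFun_moved, weakRigidityFun_moved]
  have hker : ∀ v, fderiv ℝ (weakRigidityFun G A) p v = 0 → ∃ x, motionMap G p x = v :=
    fun v hv => isTrivialMotion_iff_mem_range.1 (h v hv)
  have hfib := eventually_fibre_subset_range (ψ := fun x : infSimilarities d G => moved p x.1)
    (l := motionMap G p) (a := 0) (F := weakRigidityFun G A)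
    (hasStrictFDerivAt_moved_subtype G p) hF hconst hker
  simp only [h0] at hfib
  by_cases hG : G = ⊥
  · subst hG
    refine Or.inr ⟨rfl, _, hfib, fun q hq _ heq => ?_⟩
    obtain ⟨x, rfl⟩ := hq (weakRigidityFun_eq_iff.2 (stronglyEquivalent_bot_iff.2 heq))
    exact ⟨Real.exp x.1.2.2, Real.exp_pos _, fun i j => norm_moved_sub p x i j⟩
  · refine Or.inl ⟨_, hfib, fun q hq _ heq i j => ?_⟩
    obtain ⟨x, rfl⟩ := hq (weakRigidityFun_eq_iff.2 heq)
    have hx : x.1.2.2 = 0 := x.2.2 hG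
    rw [norm_moved_sub, hx, Real.exp_zero, one_mul]

/-- The velocity of a curve of configurations congruent to the initial one is an infinitesimal
isometry. -/
theorem exists_velocity_eq_of_congruent {w : ℝ → Config d n} {v : Config d n}
    (hw : HasDerivAt w v 0) (hc : ∀ᶠ t in 𝓝 (0 : ℝ), Congruent (w t) (w 0)) :
    ∃ (t : EuclideanSpace ℝ (Fin d)) (J : EuclideanSpace ℝ (Fin d) →L[ℝ] EuclideanSpace ℝ (Fin d)),
      star J = -J ∧ ∀ i, v i = t + J (w 0 i) := by
  rcases n.eq_zero_or_pos with rfl | hn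
  · exact ⟨0, 0, (star_zero (EuclideanSpace ℝ (Fin d) →L[ℝ] EuclideanSpace ℝ (Fin d))).trans
      neg_zero.symm, fun i => i.elim0⟩
  let o : Fin n := ⟨0, hn⟩
  let x : ℝ → Fin n → EuclideanSpace ℝ (Fin d) := fun t i => w t i - w t o
  have hx : ∀ i, HasDerivAt (fun t => x t i) (v i - v o) 0 := fun i =>
    (hasDerivAt_pi.1 hw i).sub (hasDerivAt_pi.1 hw o)
  -- By polarization, the mutual distances determine the Gram matrix of the positions relative to
  -- the base point.
  have hgram : ∀ᶠ t in 𝓝 (0 : ℝ), ∀ i j, ⟪x t i, x t j⟫_ℝ = ⟪x 0 i, x 0 j⟫_ℝ := by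
    filter_upwards [hc] with t ht i j
    have hsub : ∀ t, x t i - x t j = w t i - w t j := fun t => sub_sub_sub_cancel_right _ _ _
    rw [real_inner_eq_norm_mul_self_add_norm_mul_self_sub_norm_sub_mul_self_div_two,
      real_inner_eq_norm_mul_self_add_norm_mul_self_sub_norm_sub_mul_self_div_two, hsub, hsub,
      ht i o, ht j o, ht i j]
  -- The norm of a linear combination depends only on the Gram matrix, so a linear relation at time
  -- `0` persists and can be differentiated. Differentiating the Gram matrix itself gives the
  -- isometry relations.
  obtain ⟨J, hJ, hJx⟩ := exists_skewAdjoint_apply_eq (x 0) (fun i => v i - v o) (fun c h0 => by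
      have h1 : HasDerivAt (fun t => ∑ i, c i • x t i) (∑ i, c i • (v i - v o)) 0 :=
        HasDerivAt.fun_sum fun i _ => (hx i).const_smul (c i)
      have hsq : ∀ t, ‖∑ i, c i • x t i‖ ^ 2 = ∑ j, ∑ i, c j * (c i * ⟪x t i, x t j⟫_ℝ) :=
        fun t => by
        rw [← real_inner_self_eq_norm_sq]
        simp only [sum_inner, inner_sum, real_inner_smul_left, real_inner_smul_right]
      have h2 : (fun t => ∑ i, c i • x t i) =ᶠ[𝓝 0] fun _ => 0 := by
        filter_upwards [hgram] with t ht
        have h3 : ‖∑ i, c i • x t i‖ ^ 2 = ‖∑ i, c i • x 0 i‖ ^ 2 := by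
          rw [hsq, hsq]; simp only [ht]
        rw [h0] at h3
        simpa using h3
      exact h1.unique ((hasDerivAt_const _ _).congr_of_eventuallyEq h2))
    (fun i j => ((hx i).inner ℝ (hx j)).unique
      ((hasDerivAt_const (0 : ℝ) ⟪x 0 i, x 0 j⟫_ℝ).congr_of_eventuallyEq
        (hgram.mono fun t ht => ht i j)))
  refine ⟨v o - J (w 0 o), J, hJ, fun i => ?_⟩
  have h1 : J (w 0 i - w 0 o) = v i - v o := hJx i
  rw [map_sub] at h1
  rw [sub_add_eq_add_sub, add_sub_assoc, h1, add_sub_cancel]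

/-- The velocity of a curve of configurations similar to the initial one is an infinitesimal
similarity. -/
theorem exists_velocity_eq_of_proportionallyCongruent {w : ℝ → Config d n} {v : Config d n}
    (hw : HasDerivAt w v 0) (hc : ∀ᶠ t in 𝓝 (0 : ℝ), ProportionallyCongruent (w t) (w 0)) :
    ∃ (t : EuclideanSpace ℝ (Fin d)) (J : EuclideanSpace ℝ (Fin d) →L[ℝ] EuclideanSpace ℝ (Fin d))
      (c : ℝ), star J = -J ∧ ∀ i, v i = t + J (w 0 i) + c • w 0 i := by
  by_cases hall : ∀ i j, w 0 i = w 0 j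
  · have hc' : ∀ᶠ t in 𝓝 (0 : ℝ), Congruent (w t) (w 0) := by
      filter_upwards [hc] with t ⟨C, _, hC⟩ i j
      rw [hC, hall i j, sub_self, norm_zero, mul_zero]
    obtain ⟨t, J, hJ, hv⟩ := exists_velocity_eq_of_congruent hw hc'
    exact ⟨t, J, 0, hJ, fun i => by rw [hv, zero_smul, add_zero]⟩
  push Not at hall
  obtain ⟨a, b, hab⟩ := hall
  have hab' : w 0 a - w 0 b ≠ 0 := sub_ne_zero.2 hab
  have hN : ‖w 0 a - w 0 b‖ ≠ 0 := norm_ne_zero_iff.2 hab'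
  -- Rescaling by `C` keeps the distance of the two distinct points `a`, `b` fixed, so the rescaled
  -- curve is one of congruent configurations. The derivative of `C` at `0` returns, with opposite
  -- sign, as the dilation coefficient.
  let C : ℝ → ℝ := fun t => ‖w 0 a - w 0 b‖ / ‖w t a - w t b‖
  have hC0 : C 0 = 1 := div_self hN
  have hdiff : DifferentiableAt ℝ C 0 := by
    have h1 : DifferentiableAt ℝ (fun t => w t a - w t b) 0 :=
      ((hasDerivAt_pi.1 hw a).sub (hasDerivAt_pi.1 hw b)).differentiableAt
    exact (differentiableAt_const _).div (h1.norm ℝ hab') hN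
  have hd : HasDerivAt (fun t => C t • w t) (C 0 • v + deriv C 0 • w 0) 0 :=
    hdiff.hasDerivAt.smul hw
  have hcong : ∀ᶠ t in 𝓝 (0 : ℝ), Congruent (C t • w t) (C 0 • w 0) := by
    filter_upwards [hc] with t ⟨c, hc, h⟩ i j
    have h1 : C t = c⁻¹ := by
      change ‖w 0 a - w 0 b‖ / ‖w t a - w t b‖ = c⁻¹
      rw [h a b]
      field_simp
    rw [hC0, one_smul, Pi.smul_apply, Pi.smul_apply, ← smul_sub, norm_smul, h1, h i j,
      Real.norm_of_nonneg (inv_nonneg.2 hc.le), inv_mul_cancel_left₀ hc.ne']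
  obtain ⟨t, J, hJ, hv⟩ := exists_velocity_eq_of_congruent hd hcong
  refine ⟨t, J, -deriv C 0, hJ, fun i => ?_⟩
  have h := hv i
  simp only [hC0, one_smul, Pi.add_apply, Pi.smul_apply] at h
  rw [neg_smul, ← sub_eq_add_neg, ← h, add_sub_cancel_right]

/-- At a regular point, weak rigidity implies infinitesimal weak rigidity. -/
theorem IsGWR.isGIWR {p : Config d n} (hp : IsRegularPoint G A p) (h : IsGWR G A p) :
    IsGIWR G A p := by
  intro v hv
  have hrank : ∀ᶠ x in 𝓝 p, weakRigidityRank G A x ≤ weakRigidityRank G A p := by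
    filter_upwards [(isOpen_domain A).mem_nhds hp.1] with x hx
    exact hp.2.2 ⟨x, hx, rfl⟩
  obtain ⟨γ, hγ0, hγd, hγ⟩ := exists_curve_in_fibre (contDiffAt_weakRigidityFun G hp.1) hrank hv
  have hγc : Filter.Tendsto γ (𝓝 0) (𝓝 p) := by
    have := hγd.continuousAt
    rwa [ContinuousAt, hγ0] at this
  have hdom : ∀ᶠ t in 𝓝 (0 : ℝ), γ t ∈ domain A :=
    hγc.eventually ((isOpen_domain A).mem_nhds hp.1)
  rw [isTrivialMotion_iff]
  rcases h with ⟨B, hB, h⟩ | ⟨rfl, B, hB, h⟩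
  · obtain ⟨t, J, hJ, hx⟩ := exists_velocity_eq_of_congruent hγd (by
      filter_upwards [hγ, hdom, hγc.eventually hB] with t h1 h2 h3
      rw [hγ0]
      exact h _ h3 h2 (weakRigidityFun_eq_iff.1 h1))
    refine ⟨(t, J, 0), ⟨hJ, fun _ => rfl⟩, funext fun i => ?_⟩
    rw [velocity_apply, hx, hγ0, zero_smul, add_zero]
  · obtain ⟨t, J, c, hJ, hx⟩ := exists_velocity_eq_of_proportionallyCongruent hγd (by
      filter_upwards [hγ, hdom, hγc.eventually hB] with t h1 h2 h3
      rw [hγ0]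
      exact h _ h3 h2 (stronglyEquivalent_bot_iff.1 (weakRigidityFun_eq_iff.1 h1)))
    refine ⟨(t, J, c), ⟨hJ, fun h => absurd rfl h⟩, funext fun i => ?_⟩
    rw [velocity_apply, hx, hγ0]

end Equivalence

/-! ### Skew-adjoint maps in low dimension and the dimension of the Lie algebra -/

section Skew

variable {d : ℕ}

theorem inner_apply_eq_neg_of_star_eq_neg
    {J : EuclideanSpace ℝ (Fin d) →L[ℝ] EuclideanSpace ℝ (Fin d)} (hJ : star J = -J)
    (x y : EuclideanSpace ℝ (Fin d)) : ⟪J x, y⟫_ℝ = -⟪x, J y⟫_ℝ := by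
  rw [← ContinuousLinearMap.adjoint_inner_right, ← ContinuousLinearMap.star_eq_adjoint, hJ,
    neg_apply, inner_neg_right]

theorem inner_apply_self_of_star_eq_neg
    {J : EuclideanSpace ℝ (Fin d) →L[ℝ] EuclideanSpace ℝ (Fin d)} (hJ : star J = -J)
    (x : EuclideanSpace ℝ (Fin d)) : ⟪J x, x⟫_ℝ = 0 := by
  have h := inner_apply_eq_neg_of_star_eq_neg hJ x x
  rw [real_inner_comm] at h ⊢
  linarith

/-- A nonzero skew-adjoint endomorphism of a space of dimension at most three has a kernel of
dimension at most one. -/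
theorem finrank_ker_le_one_of_star_eq_neg (hd : d ≤ 3)
    {J : EuclideanSpace ℝ (Fin d) →L[ℝ] EuclideanSpace ℝ (Fin d)} (hJ : star J = -J)
    (h0 : J ≠ 0) : Module.finrank ℝ (LinearMap.ker J.toLinearMap) ≤ 1 := by
  obtain ⟨x, hx⟩ : ∃ x, J x ≠ 0 := by
    by_contra! h
    exact h0 (ContinuousLinearMap.ext h)
  have hJJ : J (J x) ≠ 0 := fun h => by
    have h1 := inner_apply_eq_neg_of_star_eq_neg hJ x (J x)
    rw [h, inner_zero_right, neg_zero, inner_self_eq_zero] at h1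
    exact hx h1
  -- These two nonzero vectors are orthogonal, so the rank is at least two and rank-nullity leaves
  -- at most one dimension for the kernel.
  let y : Fin 2 → LinearMap.range J.toLinearMap := ![⟨J x, x, rfl⟩, ⟨J (J x), J x, rfl⟩]
  have hy : LinearIndependent ℝ y := by
    rw [LinearIndependent.pair_iff]
    intro a b hab
    have h1 : a • J x + b • J (J x) = 0 := congrArg Subtype.val hab
    have ha : a = 0 := by
      have h2 := congrArg (fun z => ⟪z, J x⟫_ℝ) h1
      simp only [inner_add_left, real_inner_smul_left, inner_apply_self_of_star_eq_neg hJ,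
        mul_zero, add_zero, inner_zero_left, mul_eq_zero, inner_self_eq_zero] at h2
      exact h2.resolve_right hx
    rw [ha, zero_smul, zero_add] at h1
    exact ⟨ha, (smul_eq_zero.1 h1).resolve_right hJJ⟩
  have h2 := hy.fintype_card_le_finrank
  have h3 := J.toLinearMap.finrank_range_add_finrank_ker
  rw [finrank_euclideanSpace_fin] at h3
  rw [Fintype.card_fin] at h2
  omega

/-- The strictly upper triangular matrix entries of an endomorphism. -/
noncomputable def upperEntries (d : ℕ) :
    (EuclideanSpace ℝ (Fin d) →L[ℝ] EuclideanSpace ℝ (Fin d)) →ₗ[ℝ]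
      ({ij : Fin d × Fin d // ij.1 < ij.2} → ℝ) where
  toFun J ij := ⟪EuclideanSpace.basisFun (Fin d) ℝ ij.1.1,
    J (EuclideanSpace.basisFun (Fin d) ℝ ij.1.2)⟫_ℝ
  map_add' J K := by
    funext ij
    simp only [add_apply, inner_add_right, Pi.add_apply]
  map_smul' c J := by
    funext ij
    simp only [smul_apply, real_inner_smul_right, Pi.smul_apply, smul_eq_mul, RingHom.id_apply]

theorem eq_zero_of_upperEntries_eq_zero
    {J : EuclideanSpace ℝ (Fin d) →L[ℝ] EuclideanSpace ℝ (Fin d)} (hJ : star J = -J)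
    (h : upperEntries d J = 0) : J = 0 := by
  let b := EuclideanSpace.basisFun (Fin d) ℝ
  have hlt : ∀ i j, i < j → ⟪b i, J (b j)⟫_ℝ = 0 := fun i j hij => congrFun h ⟨(i, j), hij⟩
  have hall : ∀ i j, ⟪b i, J (b j)⟫_ℝ = 0 := by
    intro i j
    rcases lt_trichotomy i j with hij | rfl | hij
    · exact hlt i j hij
    · rw [real_inner_comm]
      exact inner_apply_self_of_star_eq_neg hJ _
    · rw [real_inner_comm, inner_apply_eq_neg_of_star_eq_neg hJ, hlt j i hij, neg_zero]
  have hlin : J.toLinearMap = 0 := b.toBasis.ext fun j => by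
    refine InnerProductSpace.ext_inner_left_basis b.toBasis fun i => ?_
    rw [OrthonormalBasis.coe_toBasis]
    simpa using hall i j
  exact ContinuousLinearMap.coe_injective hlin

theorem eq_of_upperEntries_eq
    {J K : EuclideanSpace ℝ (Fin d) →L[ℝ] EuclideanSpace ℝ (Fin d)} (hJ : star J = -J)
    (hK : star K = -K) (h : upperEntries d J = upperEntries d K) : J = K := by
  refine sub_eq_zero.1 (eq_zero_of_upperEntries_eq_zero ?_ ?_)
  · exact (star_sub J K).trans (by rw [hJ, hK, neg_sub_neg, neg_sub])
  · rw [map_sub, h, sub_self]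

/-- A skew-adjoint map is determined by its matrix entries above the diagonal. Only the upper bound
is needed for the dimension count. -/
theorem finrank_infSimilarities_le {n : ℕ} (G : SimpleGraph (Fin n)) :
    Module.finrank ℝ (infSimilarities d G) ≤
      d + (Fintype.card {ij : Fin d × Fin d // ij.1 < ij.2} + 1) := by
  let f : infSimilarities d G →ₗ[ℝ]
      EuclideanSpace ℝ (Fin d) × ({ij : Fin d × Fin d // ij.1 < ij.2} → ℝ) × ℝ :=
    (LinearMap.prodMap LinearMap.id (LinearMap.prodMap (upperEntries d) LinearMap.id)) ∘ₗ
      (infSimilarities d G).subtype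
  have hf : Function.Injective f := by
    rintro ⟨⟨t, J, c⟩, hJ, hc⟩ ⟨⟨t', J', c'⟩, hJ', hc'⟩ h
    have h1 : t = t' := congrArg Prod.fst h
    have h2 : upperEntries d J = upperEntries d J' := congrArg (fun z => z.2.1) h
    have h3 : c = c' := congrArg (fun z => z.2.2) h
    exact Subtype.ext (Prod.ext h1 (Prod.ext (eq_of_upperEntries_eq hJ hJ' h2) h3))
  refine (LinearMap.finrank_le_finrank_of_injective hf).trans_eq ?_
  rw [Module.finrank_prod, Module.finrank_prod, finrank_euclideanSpace_fin,
    Module.finrank_fintype_fun_eq_card, Module.finrank_self]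

theorem finrank_infSimilarities_le_of_ne_bot {n : ℕ} {G : SimpleGraph (Fin n)} (hG : G ≠ ⊥) :
    Module.finrank ℝ (infSimilarities d G) ≤
      d + Fintype.card {ij : Fin d × Fin d // ij.1 < ij.2} := by
  let f : infSimilarities d G →ₗ[ℝ]
      EuclideanSpace ℝ (Fin d) × ({ij : Fin d × Fin d // ij.1 < ij.2} → ℝ) :=
    (LinearMap.prodMap LinearMap.id (upperEntries d ∘ₗ LinearMap.fst ℝ _ ℝ)) ∘ₗ
      (infSimilarities d G).subtype
  have hf : Function.Injective f := by
    rintro ⟨⟨t, J, c⟩, hJ, hc⟩ ⟨⟨t', J', c'⟩, hJ', hc'⟩ h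
    have h1 : t = t' := congrArg Prod.fst h
    have h2 : upperEntries d J = upperEntries d J' := congrArg (fun z => z.2) h
    exact Subtype.ext (Prod.ext h1 (Prod.ext (eq_of_upperEntries_eq hJ hJ' h2) ((hc hG).trans (hc' hG).symm)))
  refine (LinearMap.finrank_le_finrank_of_injective hf).trans_eq ?_
  rw [Module.finrank_prod, finrank_euclideanSpace_fin, Module.finrank_fintype_fun_eq_card]

end Skew

/-! ### Collinear configurations have large nullity -/

section Collinear

variable {d n : ℕ} {G : SimpleGraph (Fin n)} {A : Finset (Fin n × Fin n × Fin n)}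

/-- A configuration of points of one line. -/
def IsCollinear (q : Config d n) : Prop :=
  ∃ (a u : EuclideanSpace ℝ (Fin d)) (s : Fin n → ℝ), ∀ i, q i = a + s i • u

/-- In dimension at most three, only the points of a line can be fixed by a nonzero infinitesimal
similarity. -/
theorem isCollinear_of_not_injective (hd : d ≤ 3) (hn : 0 < n) {q : Config d n}
    (h : ¬ Function.Injective (motionMap G q)) : IsCollinear q := by
  have h' : ∃ x, motionMap G q x = 0 ∧ x ≠ 0 := by
    by_contra! hx
    exact h ((injective_iff_map_eq_zero _).2 hx)
  obtain ⟨⟨⟨t, J, c⟩, hJ, hc⟩, hv, hx⟩ := h'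
  have hJ' : star J = -J := hJ
  have hq : ∀ i, t + J (q i) + c • q i = 0 := fun i => congrFun hv i
  let o : Fin n := ⟨0, hn⟩
  have hw : ∀ i, J (q i - q o) + c • (q i - q o) = 0 := fun i => by
    rw [map_sub, smul_sub]
    have := congrArg₂ (· - ·) (hq i) (hq o)
    simp only [sub_self] at this
    rw [← this]
    abel
  -- The differences of the points lie in the kernel of `J + c`. If `c = 0`, then `J ≠ 0`, since
  -- otherwise the translation would vanish too, and the kernel of `J` is at most a line. If `c ≠
  -- 0`, pairing a difference with itself removes `J` and forces all points to coincide.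
  by_cases hc0 : c = 0
  · have hJ0 : J ≠ 0 := by
      rintro rfl
      have ht := hq o
      simp only [hc0, zero_apply, zero_smul, add_zero] at ht
      exact hx (Subtype.ext (Prod.ext ht (Prod.ext rfl hc0)))
    obtain ⟨u, hu⟩ := finrank_le_one_iff.1 (finrank_ker_le_one_of_star_eq_neg hd hJ' hJ0)
    have hker : ∀ i, q i - q o ∈ LinearMap.ker J.toLinearMap := fun i => by
      have := hw i
      rwa [hc0, zero_smul, add_zero] at this
    choose s hs using fun i => hu ⟨q i - q o, hker i⟩
    refine ⟨q o, u, s, fun i => ?_⟩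
    have h1 : s i • (u : EuclideanSpace ℝ (Fin d)) = q i - q o := congrArg Subtype.val (hs i)
    rw [h1, add_sub_cancel]
  · refine ⟨q o, 0, 0, fun i => ?_⟩
    have h1 := congrArg (fun z => ⟪z, q i - q o⟫_ℝ) (hw i)
    simp only [inner_add_left, inner_apply_self_of_star_eq_neg hJ', real_inner_smul_left, zero_add,
      inner_zero_left, mul_eq_zero, hc0, inner_self_eq_zero, false_or] at h1
    rw [smul_zero, add_zero]
    exact sub_eq_zero.1 h1

/-- The cosine of an angle is critical at a collinear configuration. -/
theorem IsCollinear.fderiv_cosAngle_eq_zero {q : Config d n} (hq : IsCollinear q)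
    {a : Fin n × Fin n × Fin n} (h1 : q a.1 ≠ q a.2.1) (h2 : q a.1 ≠ q a.2.2) :
    fderiv ℝ (cosAngle a) q = 0 := by
  obtain ⟨b, u, s, hs⟩ := hq
  have hsub : ∀ i j, q i - q j = (s i - s j) • u := fun i j => by
    rw [hs, hs, add_sub_add_left_eq_sub, sub_smul]
  have hne : ∀ i j, q i ≠ q j → s j - s i ≠ 0 := fun i j hij h => by
    refine hij (sub_eq_zero.1 ?_).symm
    rw [hsub, h, zero_smul]
  -- The cosine takes an extreme value at `q`, so Fermat's criterion applies.
  have habs : |cosAngle a q| = 1 := by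
    rw [cosAngle_eq_div]
    refine (abs_real_inner_div_norm_mul_norm_eq_one_iff _ _).2
      ⟨sub_ne_zero.2 h1.symm, (s a.2.2 - s a.1) / (s a.2.1 - s a.1),
        div_ne_zero (hne _ _ h2) (hne _ _ h1), ?_⟩
    rw [hsub, hsub, smul_smul, div_mul_cancel₀ _ (hne _ _ h1)]
  rcases eq_or_eq_neg_of_abs_eq habs with h | h
  · refine IsLocalMax.fderiv_eq_zero (Filter.Eventually.of_forall fun p => ?_)
    rw [h]
    exact Real.cos_le_one _
  · refine IsLocalMin.fderiv_eq_zero (Filter.Eventually.of_forall fun p => ?_)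
    rw [h]
    exact Real.neg_one_le_cos _

theorem IsCollinear.isInfinitesimalMotion {q v : Config d n} (hq : IsCollinear q)
    (hd : q ∈ domain A) (hv : ∀ i j, G.Adj i j → ⟪q i - q j, v i - v j⟫_ℝ = 0) :
    weakRigidityMatrix G A q v = 0 := by
  funext r
  rcases r with e | a
  · rw [weakRigidityMatrix_apply_edge hd, hv _ _ e.2.2, mul_zero]
    rfl
  · rw [weakRigidityMatrix_apply_angle hd,
      hq.fderiv_cosAngle_eq_zero (hd a.1 a.2).1 (hd a.1 a.2).2]
    rfl

theorem finrank_config : Module.finrank ℝ (Config d n) = n * d := by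
  rw [Module.finrank_pi_fintype]
  simp

theorem IsCollinear.finrank_ker_bot {q : Config d n} (hq : IsCollinear q) (hd : q ∈ domain A) :
    Module.finrank ℝ (LinearMap.ker (weakRigidityMatrix ⊥ A q)) = n * d := by
  have : LinearMap.ker (weakRigidityMatrix ⊥ A q) = ⊤ := by
    rw [eq_top_iff]
    exact fun v _ => hq.isInfinitesimalMotion hd fun _ _ h => h.elim
  rw [this, finrank_top, finrank_config]

/-- Only the edge rows survive, and they see nothing but the components of the velocities along the
line. The `n - 1` equations making these components equal already imply `R_W(q) v = 0`. -/
theorem IsCollinear.le_finrank_ker (hn : 0 < n) {q : Config d n} (hq : IsCollinear q)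
    (hd : q ∈ domain A) :
    n * d + 1 ≤ n + Module.finrank ℝ (LinearMap.ker (weakRigidityMatrix G A q)) := by
  obtain ⟨m, rfl⟩ := Nat.exists_eq_add_one.2 hn
  obtain ⟨b, u, s, hs⟩ := id hq
  let f : Config d (m + 1) →ₗ[ℝ] (Fin m → ℝ) :=
    { toFun := fun v i => ⟪u, v i.succ - v 0⟫_ℝ
      map_add' := fun v w => by
        funext i
        simp only [Pi.add_apply, inner_sub_right, inner_add_right]
        ring
      map_smul' := fun c v => by
        funext i
        simp only [Pi.smul_apply, inner_sub_right, real_inner_smul_right, RingHom.id_apply,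
          smul_eq_mul]
        ring }
  have hle : LinearMap.ker f ≤ LinearMap.ker (weakRigidityMatrix G A q) := by
    intro v hv
    have h0 : ∀ i, ⟪u, v i⟫_ℝ = ⟪u, v 0⟫_ℝ := fun i => by
      refine Fin.cases rfl (fun i => ?_) i
      have : ⟪u, v i.succ - v 0⟫_ℝ = 0 := congrFun hv i
      rwa [inner_sub_right, sub_eq_zero] at this
    refine hq.isInfinitesimalMotion hd fun i j _ => ?_
    rw [hs, hs, add_sub_add_left_eq_sub, ← sub_smul, real_inner_smul_left, inner_sub_right, h0 i,
      h0 j, sub_self, mul_zero]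
  have h1 := Submodule.finrank_mono hle
  have h2 := f.finrank_range_add_finrank_ker
  have h3 := (LinearMap.range f).finrank_le
  rw [finrank_config] at h2
  rw [Module.finrank_fin_fun] at h3
  omega

end Collinear

/-! ### Transfer between regular points -/

section Generic

variable {d n : ℕ} {G : SimpleGraph (Fin n)} {A : Finset (Fin n × Fin n × Fin n)}

theorem IsRegularPoint.finrank_ker_eq {p q : Config d n} (hp : IsRegularPoint G A p)
    (hq : IsRegularPoint G A q) :
    Module.finrank ℝ (LinearMap.ker (weakRigidityMatrix G A p)) =
      Module.finrank ℝ (LinearMap.ker (weakRigidityMatrix G A q)) := by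
  have h1 := (weakRigidityMatrix G A p).finrank_range_add_finrank_ker
  have h2 := (weakRigidityMatrix G A q).finrank_range_add_finrank_ker
  have h3 : Module.finrank ℝ (LinearMap.range (weakRigidityMatrix G A p)) =
    Module.finrank ℝ (LinearMap.range (weakRigidityMatrix G A q)) := hp.2.unique hq.2
  omega

theorem IsGIWR.finrank_ker_le {p : Config d n} (h : IsGIWR G A p) :
    Module.finrank ℝ (LinearMap.ker (weakRigidityMatrix G A p)) ≤
      Module.finrank ℝ (infSimilarities d G) := by
  have hle : LinearMap.ker (weakRigidityMatrix G A p) ≤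
      LinearMap.range (motionMap G p).toLinearMap :=
    fun v hv => isTrivialMotion_iff_mem_range.1 (h v hv)
  exact (Submodule.finrank_mono hle).trans (LinearMap.finrank_range_le _)

/-- The trivial motions always lie in the kernel; by injectivity their dimension is that of the Lie
algebra, so the bound forces equality. -/
theorem isGIWR_of_injective {q : Config d n} (hq : q ∈ domain A)
    (hinj : Function.Injective (motionMap G q))
    (h : Module.finrank ℝ (LinearMap.ker (weakRigidityMatrix G A q)) ≤
      Module.finrank ℝ (infSimilarities d G)) : IsGIWR G A q := by
  have hle : LinearMap.range (motionMap G q).toLinearMap ≤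
      LinearMap.ker (weakRigidityMatrix G A q) := fun v hv =>
    (isTrivialMotion_iff_mem_range.2 hv).isInfinitesimalMotion hq
  have hr : Module.finrank ℝ (LinearMap.range (motionMap G q).toLinearMap) =
    Module.finrank ℝ (infSimilarities d G) := LinearMap.finrank_range_of_inj hinj
  have heq := Submodule.eq_of_le_of_finrank_le hle (h.trans_eq hr.symm)
  intro v hv
  have hv' : v ∈ LinearMap.ker (weakRigidityMatrix G A q) := hv
  rw [← heq] at hv'
  exact isTrivialMotion_iff_mem_range.2 hv'

theorem IsGIWR.of_isRegularPoint_of_three_le (hd : d = 2 ∨ d = 3) (hn : 3 ≤ n) {p q : Config d n}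
    (hp : IsRegularPoint G A p) (hq : IsRegularPoint G A q) (h : IsGIWR G A p) :
    IsGIWR G A q := by
  have hk := (hp.finrank_ker_eq hq).symm.trans_le h.finrank_ker_le
  by_cases hinj : Function.Injective (motionMap G q)
  · exact isGIWR_of_injective hq.1 hinj hk
  exfalso
  have hcol := isCollinear_of_not_injective (by omega) (by omega) hinj
  by_cases hG : G = ⊥
  · subst hG
    rw [hcol.finrank_ker_bot hq.1] at hk
    -- Without edges `R_W(q) = 0`, so the bound reads `2n ≤ 4` for `d = 2` and `3n ≤ 7` for `d = 3`.
    have hk' := hk.trans (finrank_infSimilarities_le _)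
    rcases hd with rfl | rfl
    · have : Fintype.card {ij : Fin 2 × Fin 2 // ij.1 < ij.2} = 1 := by decide
      omega
    · have : Fintype.card {ij : Fin 3 × Fin 3 // ij.1 < ij.2} = 3 := by decide
      omega
  · have hl := hcol.le_finrank_ker (G := G) (by omega) hq.1
    -- Combined with `hl` this gives `2n + 1 ≤ n + 3` for `d = 2` and `3n + 1 ≤ n + 6` for `d = 3`,
    -- both impossible for `n ≥ 3`.
    have hk' := hk.trans (finrank_infSimilarities_le_of_ne_bot hG)
    rcases hd with rfl | rfl
    · have : Fintype.card {ij : Fin 2 × Fin 2 // ij.1 < ij.2} = 1 := by decide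
      omega
    · have : Fintype.card {ij : Fin 3 × Fin 3 // ij.1 < ij.2} = 3 := by decide
      omega

theorem isGIWR_of_le_one (hn : n ≤ 1) (q : Config d n) : IsGIWR G A q := by
  have : Subsingleton (Fin n) := Fin.subsingleton_iff_le_one.2 hn
  intro v _
  rcases n.eq_zero_or_pos with rfl | h0
  · exact ⟨0, 0, 0, by simp, fun _ => rfl, fun i => i.elim0⟩
  · refine ⟨v ⟨0, h0⟩, 0, 0, by simp, fun _ => rfl, fun i => ?_⟩
    rw [Subsingleton.elim i ⟨0, h0⟩]
    simp

/-- A framework on two distinct points is infinitesimally weakly rigid. -/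
theorem isGIWR_of_two {G : SimpleGraph (Fin 2)} {A : Finset (Fin 2 × Fin 2 × Fin 2)}
    {q : Config d 2} (hq : q ∈ domain A) (h01 : q 0 ≠ q 1) : IsGIWR G A q := by
  intro v hv
  have hw : q 1 - q 0 ≠ 0 := sub_ne_zero.2 h01.symm
  have hw' : ⟪q 1 - q 0, q 1 - q 0⟫_ℝ ≠ 0 := fun h => hw (inner_self_eq_zero.1 h)
  -- The component of the relative velocity along `q 1 - q 0` is a dilation; the remainder is
  -- orthogonal to `q 1 - q 0`, hence comes from a rotation. If the edge is present, its row of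
  -- `R_W(q)` forces `c = 0`.
  let c : ℝ := ⟪q 1 - q 0, v 1 - v 0⟫_ℝ / ⟪q 1 - q 0, q 1 - q 0⟫_ℝ
  obtain ⟨J, hJ, hJw⟩ := exists_skewAdjoint_apply_eq (fun _ : Unit => q 1 - q 0)
    (fun _ => v 1 - v 0 - c • (q 1 - q 0))
    (fun b hb => by
      simp only [Finset.univ_unique, Finset.sum_singleton] at hb ⊢
      rw [(smul_eq_zero.1 hb).resolve_right hw, zero_smul])
    (fun _ _ => by
      rw [real_inner_comm (q 1 - q 0), inner_sub_right, real_inner_smul_right,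
        div_mul_cancel₀ _ hw', sub_self, add_zero])
  have hJw' : J (q 1) - J (q 0) = v 1 - v 0 - c • (q 1 - q 0) := by
    rw [← map_sub]
    exact hJw ()
  refine isTrivialMotion_iff.2 ⟨(v 0 - J (q 0) - c • q 0, J, c), ⟨hJ, fun hG => ?_⟩, ?_⟩
  · have hadj : G.Adj 0 1 := by
      obtain ⟨i, j, hij⟩ := SimpleGraph.ne_bot_iff_exists_adj.1 hG
      fin_cases i <;> fin_cases j
      · exact (hij.ne rfl).elim
      · exact hij
      · exact hij.symm
      · exact (hij.ne rfl).elim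
    have h1 := congrFun (show weakRigidityMatrix G A q v = 0 from hv)
      (Sum.inl ⟨(0, 1), by decide, hadj⟩)
    rw [weakRigidityMatrix_apply_edge hq] at h1
    have h2 : ⟪q 0 - q 1, v 0 - v 1⟫_ℝ = 0 := by
      simpa using h1
    change ⟪q 1 - q 0, v 1 - v 0⟫_ℝ / _ = 0
    rw [← neg_sub (q 0), ← neg_sub (v 0), inner_neg_neg, h2, zero_div]
  · funext i
    rw [velocity_apply]
    fin_cases i
    · change v 0 - J (q 0) - c • q 0 + J (q 0) + c • q 0 = v 0
      abel
    · change v 0 - J (q 0) - c • q 0 + J (q 1) + c • q 1 = v 1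
      rw [sub_eq_iff_eq_add.1 hJw', smul_sub]
      abel

/-- Coinciding points leave no angle defined, so `A` is empty and there is an edge. Then `R_W(q) =
0`, whereas the edge row is nonzero at two distinct points, against the maximality of the rank at
`q`. -/
theorem IsRegularPoint.ne_of_two (hd : 0 < d) {G : SimpleGraph (Fin 2)}
    {A : Finset (Fin 2 × Fin 2 × Fin 2)} (hn : G ≠ ⊥ ∨ A.Nonempty) {q : Config d 2}
    (hq : IsRegularPoint G A q) : q 0 ≠ q 1 := by
  intro h01
  have hall : ∀ i j, q i = q j := fun i j => by
    fin_cases i <;> fin_cases j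
    · rfl
    · exact h01
    · exact h01.symm
    · rfl
  have hA : A = ∅ := by
    by_contra hA
    obtain ⟨a, ha⟩ := Finset.nonempty_iff_ne_empty.2 hA
    exact (hq.1 a ha).1 (hall _ _)
  subst hA
  have hG : G ≠ ⊥ := hn.resolve_right Finset.not_nonempty_empty
  obtain ⟨i, j, hij⟩ := SimpleGraph.ne_bot_iff_exists_adj.1 hG
  have hcol : IsCollinear q := ⟨q 0, 0, 0, fun i => by rw [smul_zero, add_zero, hall i 0]⟩
  have hq0 : weakRigidityMatrix G ∅ q = 0 := LinearMap.ext fun v =>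
    hcol.isInfinitesimalMotion hq.1 fun i j _ => by rw [hall i j, sub_self, inner_zero_left]
  let e : EuclideanSpace ℝ (Fin d) := EuclideanSpace.basisFun (Fin d) ℝ ⟨0, hd⟩
  have he : e ≠ 0 := (EuclideanSpace.basisFun (Fin d) ℝ).orthonormal.ne_zero _
  let r : Config d 2 := ![0, e]
  have hr : r ∈ domain (∅ : Finset (Fin 2 × Fin 2 × Fin 2)) := fun a ha => by simp at ha
  have hrank : weakRigidityRank G ∅ r ≤ weakRigidityRank G ∅ q := hq.2.2 ⟨r, hr, rfl⟩
  have hr0 : weakRigidityMatrix G ∅ r = 0 := by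
    rw [← LinearMap.range_eq_bot, ← Submodule.finrank_eq_zero (R := ℝ), ← Nat.le_zero]
    refine hrank.trans_eq ?_
    rw [weakRigidityRank, hq0, LinearMap.range_zero, finrank_bot]
  have hadj : G.Adj 0 1 := by
    fin_cases i <;> fin_cases j
    · exact (hij.ne rfl).elim
    · exact hij
    · exact hij.symm
    · exact (hij.ne rfl).elim
  have h1 := weakRigidityMatrix_apply_edge (G := G) hr r ⟨(0, 1), by decide, hadj⟩
  rw [hr0] at h1
  have h2 : ⟪(0 : EuclideanSpace ℝ (Fin d)) - e, 0 - e⟫_ℝ = 0 := by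
    have h3 : (0 : ℝ) = 2 * ⟪(0 : EuclideanSpace ℝ (Fin d)) - e, 0 - e⟫_ℝ := h1
    linarith
  rw [inner_self_eq_zero, zero_sub, neg_eq_zero] at h2
  exact he h2

/-- Two points are always collinear, so the dimension count gives no contradiction for `n = 2`. With
neither edges nor angles every configuration is regular, but two coinciding points are not GIWR
while two distinct ones are; this is what `hn` excludes. -/
theorem IsGIWR.of_isRegularPoint (hd : d = 2 ∨ d = 3) (hn : n = 2 → G ≠ ⊥ ∨ A.Nonempty)
    {p q : Config d n} (hp : IsRegularPoint G A p) (hq : IsRegularPoint G A q)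
    (h : IsGIWR G A p) : IsGIWR G A q := by
  rcases lt_trichotomy n 2 with h2 | rfl | h2
  · exact isGIWR_of_le_one (by omega) q
  · exact isGIWR_of_two hq.1 (hq.ne_of_two (by omega) (hn rfl))
  · exact h.of_isRegularPoint_of_three_le hd h2 hp hq

theorem isGenericProperty_of_imp {P : Config d n → Prop}
    (h : ∀ p q, IsRegularPoint G A p → IsRegularPoint G A q → P p → P q) :
    IsGenericProperty G A P := by
  by_cases hp : ∃ p, IsRegularPoint G A p ∧ P p
  · obtain ⟨p, hp, hP⟩ := hp
    exact Or.inl fun q hq => h p q hp hq hP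
  · exact Or.inr fun p hp' hP => hp ⟨p, hp', hP⟩

end Generic

end WeakRigidity

theorem mainTheorem5 (d n : ℕ) (hd : d = 2 ∨ d = 3)
    (G : SimpleGraph (Fin n)) (A : Finset (Fin n × Fin n × Fin n))
    (hn : n = 2 → G ≠ ⊥ ∨ A.Nonempty) :
    (∀ p q : WeakRigidity.Config d n,
      WeakRigidity.IsRegularPoint G A p → WeakRigidity.IsRegularPoint G A q →
        (WeakRigidity.IsGWR G A p → WeakRigidity.IsGWR G A q) ∧
        (WeakRigidity.IsGIWR G A p → WeakRigidity.IsGIWR G A q)) ∧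
    WeakRigidity.IsGenericProperty G A
      (WeakRigidity.IsGWR G A : WeakRigidity.Config d n → Prop) ∧
    WeakRigidity.IsGenericProperty G A
      (WeakRigidity.IsGIWR G A : WeakRigidity.Config d n → Prop) := by
  have hgiwr : ∀ p q : WeakRigidity.Config d n, WeakRigidity.IsRegularPoint G A p →
      WeakRigidity.IsRegularPoint G A q → WeakRigidity.IsGIWR G A p → WeakRigidity.IsGIWR G A q :=
    fun p q hp hq h => h.of_isRegularPoint hd hn hp hq
  have hgwr : ∀ p q : WeakRigidity.Config d n, WeakRigidity.IsRegularPoint G A p →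
      WeakRigidity.IsRegularPoint G A q → WeakRigidity.IsGWR G A p → WeakRigidity.IsGWR G A q :=
    fun p q hp hq h => (hgiwr p q hp hq (h.isGIWR hp)).isGWR hq.1
  exact ⟨fun p q hp hq => ⟨hgwr p q hp hq, hgiwr p q hp hq⟩,
    WeakRigidity.isGenericProperty_of_imp hgwr, WeakRigidity.isGenericProperty_of_imp hgiwr⟩
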